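/- Work in the first-order language $L=\{R\}$ of graphs. For an integer $r\ge 2$ let $\mathcal{T}_r$ be the $L$-theory of the $r$-regular infinite tree, axiomatized by sentences saying that $R$ is irreflexive and symmetric, that every vertex has degree exactly $r$, and that there are no cycles (of any length $n\ge 3$). Let $\mathcal{T}_\infty$ be the $L$-theory of the infinite-branching tree, axiomatized by sentences saying that $R$ is irreflexive and symmetric, that every vertex has at least $n$ neighbours (for each $n\in\mathbb{N}$), and that there are no cycles. Call a structure $M$ pseudofinite if every first-order sentence true in $M$ is true in some finite (nonempty) structure, and call a theory pseudofinite if all its (nonempty) models are pseudofinite. **Theorem.** For every $r\ge 2$ the theories $\mathcal{T}_r$ and $\mathcal{T}_\infty$ are complete and pseudofinite. Moreover: 1. For every $r\ge 2$ there is a sequence $(G_k)_{k\in\mathbb{N}}$ of finite nonempty $r$-regular graphs with $\operatorname{girth}(G_k)\to\infty$ such that, for every non-principal ultrafilter $\mathcal{U}$ on $\mathbb{N}$, the ultraproduct $\prod_{\mathcal{U}}G_k$ is a model of $\mathcal{T}_r$. 2. There are a function $d:\mathbb{N}\to\mathbb{N}$ with $d(k)\to\infty$ and a sequence $(H_k)_{k\in\mathbb{N}}$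 of finite nonempty graphs such that each $H_k$ is $d(k)$-regular, $\operatorname{girth}(H_k)\to\infty$, and, for every non-principal ultrafilter $\mathcal{U}$ on $\mathbb{N}$, the ultraproduct $\prod_{\mathcal{U}}H_k$ is a model of $\mathcal{T}_\infty$. Here the girth of a graph is the length of its shortest cycle. -/

import Mathlib

universe u v w

namespace TreeTheories

open FirstOrder FirstOrder.Language

noncomputable section

/-- The atomic formula `x R y` of the language of graphs. -/
def edge {α : Type} (x y : α) : Language.graph.Formula α :=
  adj.formula₂ (Term.var x) (Term.var y)

/-- The formula `x = y` of the language of graphs. -/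
def eqv {α : Type} (x y : α) : Language.graph.Formula α :=
  Term.equal (Term.var x) (Term.var y)

/-- The formula saying that the variables `y i`, `i : Fin n`, are pairwise distinct. -/
def distinct {α : Type} {n : ℕ} (y : Fin n → α) : Language.graph.Formula α :=
  Formula.iInf fun p : {p : Fin n × Fin n // p.1 < p.2} =>
    (eqv (y p.1.1) (y p.1.2)).not

/-- `∀ x, ∃ y₁ … yₙ`, pairwise distinct and all adjacent to `x`:
every vertex has at least `n` neighbours. -/
def degreeAtLeast (n : ℕ) : Language.graph.Sentence :=
  Formula.iAlls (α := Empty) Unit <|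
    Formula.iExs (Fin n) <|
      distinct (fun i : Fin n => Sum.inr i) ⊓
        Formula.iInf fun i : Fin n => edge (Sum.inl (Sum.inr ())) (Sum.inr i)

/-- `∀ x, ∃ y₁ … yᵣ`, pairwise distinct, all adjacent to `x`, and such that every `z` adjacent
to `x` is one of them: every vertex has degree exactly `r`. -/
def degreeExactly (r : ℕ) : Language.graph.Sentence :=
  Formula.iAlls (α := Empty) Unit <|
    Formula.iExs (Fin r) <|
      (distinct (fun i : Fin r => Sum.inr i) ⊓
        Formula.iInf fun i : Fin r => edge (Sum.inl (Sum.inr ())) (Sum.inr i)) ⊓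
          Formula.iAlls Unit
            ((edge (Sum.inl (Sum.inl (Sum.inr ()))) (Sum.inr ())).imp
              (Formula.iSup fun i : Fin r => eqv (Sum.inr ()) (Sum.inl (Sum.inr i))))

/-- There is no cycle of length `n + 3`: no pairwise distinct `y₀, …, y₍ₙ₊₂₎` with `yᵢ R yᵢ₊₁`
for all `i`, where the addition on `Fin (n + 3)` is cyclic. -/
def noCycle (n : ℕ) : Language.graph.Sentence :=
  Formula.iAlls (α := Empty) (Fin (n + 3)) <|
    (distinct (fun i : Fin (n + 3) => Sum.inr i) ⊓
      Formula.iInf fun i : Fin (n + 3) => edge (Sum.inr i) (Sum.inr (i + 1))).not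

/-- The theory of the infinite-branching tree: simple graphs without cycles in which every vertex
has infinite degree. -/
def infiniteBranchingTree : Language.graph.Theory :=
  Theory.simpleGraph ∪ Set.range degreeAtLeast ∪ Set.range noCycle

/-- The theory of the `r`-regular tree: simple graphs without cycles in which every vertex has
degree `r`. -/
def regularTree (r : ℕ) : Language.graph.Theory :=
  Theory.simpleGraph ∪ {degreeExactly r} ∪ Set.range noCycle

end

/-- A structure is pseudofinite if every sentence true in it is true in some finite structure. -/
def PseudofiniteStructure (L : FirstOrder.Language.{u, v}) (M : Type w) [L.Structure M] : Prop :=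
  ∀ φ : L.Sentence, M ⊨ φ →
    ∃ (N : Type) (_ : L.Structure N), Finite N ∧ Nonempty N ∧ N ⊨ φ

/-- A theory is pseudofinite if all its (nonempty) models are. -/
def PseudofiniteTheory {L : FirstOrder.Language.{u, v}} (T : L.Theory) : Prop :=
  ∀ (M : Type w) [L.Structure M] [Nonempty M], M ⊨ T → PseudofiniteStructure L M

/-- The ultraproduct of the graphs `G i` along `U`, a structure in the language of graphs,
is a model of `T`. -/
def UltraproductModels {ι : Type} {V : ι → Type} (G : ∀ i, SimpleGraph (V i)) (U : Ultrafilter ι)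
    (T : Language.graph.Theory) : Prop :=
  letI : ∀ i, Language.graph.Structure (V i) := fun i => (G i).structure
  (U : Filter ι).Product V ⊨ T

end TreeTheories

namespace TreeTheories

open FirstOrder FirstOrder.Language

/-! Completeness is a back-and-forth argument. A model is a forest with constant degree `D`,
determined up to isomorphism by its number of components, which first-order logic does not see.
Passing to an ultrapower over `ℕ` makes that number infinite: a regular forest with `D ≥ 2` has
vertices arbitrarily far from any finite set, and a diagonal sequence of such vertices lies in a new
component (`manyComponents_ultrapower`). Between two forests with infinitely many components, the
finite matchings of `Matching` are partial isomorphisms, because each component meets their domain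
in a subtree, and they extend to any further vertex on either side (`Matching.forth`,
`Matching.back`). So the ultrapowers, and hence the models, are elementarily equivalent.

Satisfiability and pseudofiniteness come from finite regular graphs of large girth: the Cayley graph
`flipGraph` of the permutations of a ball in the edge-coloured tree, generated by the involutions
that move along one colour. A short non-backtracking walk carries the root of the ball away from
itself, so there is no short cycle (`lt_length_of_isCycle_flipGraph`). By Łoś an ultraproduct of
these graphs is a model of the theory, and by completeness every sentence true in some model holds
in one of the finite factors. -/

theorem _root_.Set.encard_eq_coe_iff_exists_range {α : Type*} {s : Set α} {n : ℕ} :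
    s.encard = n ↔ ∃ y : Fin n → α, Function.Injective y ∧ Set.range y = s := by
  constructor
  · intro h
    have hfin : s.Finite := Set.finite_of_encard_eq_coe h
    have : Finite s := hfin
    have hcard : Nat.card s = n := by
      rw [Nat.card_coe_set_eq, Set.ncard, h]; rfl
    let e := Finite.equivFinOfCardEq hcard
    refine ⟨fun i => e.symm i, Subtype.val_injective.comp e.symm.injective, ?_⟩
    ext z
    constructor
    · rintro ⟨i, rfl⟩
      exact (e.symm i).2
    · intro hz
      exact ⟨e ⟨z, hz⟩, by simp⟩
  · rintro ⟨y, hy, rfl⟩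
    rw [← Set.image_univ, hy.encard_image, Set.encard_univ]
    simp

theorem _root_.Set.coe_le_encard_iff_exists {α : Type*} {s : Set α} {n : ℕ} :
    (n : ℕ∞) ≤ s.encard ↔ ∃ y : Fin n → α, Function.Injective y ∧ ∀ i, y i ∈ s := by
  constructor
  · intro h
    obtain ⟨t, hts, ht⟩ := Set.exists_subset_encard_eq h
    obtain ⟨y, hy, rfl⟩ := Set.encard_eq_coe_iff_exists_range.1 ht
    exact ⟨y, hy, fun i => hts ⟨i, rfl⟩⟩
  · rintro ⟨y, hy, hs⟩
    rw [← Set.encard_eq_coe_iff_exists_range.2 ⟨y, hy, rfl⟩]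
    exact Set.encard_le_encard (Set.range_subset_iff.2 hs)

/-! ### The axioms as properties of graphs -/

section Realize

variable {α : Type} {M : Type w} [Language.graph.Structure M]

@[simp]
theorem realize_edge {x y : α} {v : α → M} :
    (edge x y).Realize v ↔ Structure.RelMap adj ![v x, v y] := by
  simp [edge, Formula.realize_rel₂]

@[simp]
theorem realize_eqv {x y : α} {v : α → M} : (eqv x y).Realize v ↔ v x = v y := by
  simp [eqv, Formula.realize_equal]

@[simp]
theorem realize_distinct {n : ℕ} {y : Fin n → α} {v : α → M} :
    (distinct y).Realize v ↔ Function.Injective fun i => v (y i) := by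
  simp only [distinct, Formula.realize_iInf, Formula.realize_not, realize_eqv, Subtype.forall,
    Prod.forall]
  refine ⟨fun h i j hij => ?_, fun h i j hij => h.ne hij.ne⟩
  by_contra hne
  rcases lt_or_gt_of_ne hne with hlt | hlt
  · exact h _ _ hlt hij
  · exact h _ _ hlt hij.symm

/-- The structure on the vertex type is the one given by the graph `G`. -/
def Represents (G : SimpleGraph M) : Prop :=
  ∀ x y, Structure.RelMap adj ![x, y] ↔ G.Adj x y

variable {G : SimpleGraph M}

theorem Represents.realize_degreeAtLeast (hG : Represents G) {n : ℕ} :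
    M ⊨ degreeAtLeast n ↔ ∀ x, (n : ℕ∞) ≤ (G.neighborSet x).encard := by
  simp only [Sentence.Realize, degreeAtLeast, Formula.realize_iAlls, Formula.realize_iExs,
    Formula.realize_inf, realize_distinct, Formula.realize_iInf, realize_edge, Sum.elim_inl,
    Sum.elim_inr, hG _ _, Set.coe_le_encard_iff_exists, SimpleGraph.mem_neighborSet]
  exact ⟨fun h x => h fun _ => x, fun h x => h (x ())⟩

theorem Represents.realize_degreeExactly (hG : Represents G) {r : ℕ} :
    M ⊨ degreeExactly r ↔ ∀ x, (G.neighborSet x).encard = r := by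
  simp only [Sentence.Realize, degreeExactly, Formula.realize_iAlls, Formula.realize_iExs,
    Formula.realize_inf, realize_distinct, Formula.realize_iInf, realize_edge, Sum.elim_inl,
    Sum.elim_inr, hG _ _, Set.encard_eq_coe_iff_exists_range, Formula.realize_imp,
    Formula.realize_iSup, realize_eqv]
  refine ⟨fun h x => ?_, fun h x => ?_⟩
  · obtain ⟨y, ⟨hy, hxy⟩, hall⟩ := h fun _ => x
    refine ⟨y, hy, Set.Subset.antisymm (Set.range_subset_iff.2 hxy) fun z hz => ?_⟩
    obtain ⟨i, hi⟩ := hall (fun _ => z) hz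
    exact ⟨i, hi.symm⟩
  · obtain ⟨y, hy, hr⟩ := h (x ())
    refine ⟨y, ⟨hy, fun i => ?_⟩, fun z hz => ?_⟩
    · have : y i ∈ G.neighborSet (x ()) := hr ▸ ⟨i, rfl⟩
      exact this
    · have : z () ∈ Set.range y := hr ▸ hz
      obtain ⟨i, hi⟩ := this
      exact ⟨i, hi.symm⟩

theorem _root_.SimpleGraph.cycleGraph_isContained_iff_exists {V : Type*} {G : SimpleGraph V}
    {n : ℕ} : (SimpleGraph.cycleGraph (n + 3)).IsContained G ↔
      ∃ y : Fin (n + 3) → V, Function.Injective y ∧ ∀ i, G.Adj (y i) (y (i + 1)) := by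
  constructor
  · rintro ⟨f⟩
    refine ⟨f, f.injective, fun i => f.toHom.map_adj ?_⟩
    rw [SimpleGraph.cycleGraph_adj]
    right
    abel
  · rintro ⟨y, hy, hadj⟩
    refine ⟨⟨⟨y, ?_⟩, hy⟩⟩
    intro a b hab
    rw [SimpleGraph.cycleGraph_adj] at hab
    rcases hab with h | h
    · obtain rfl : a = b + 1 := by rw [← h]; abel
      exact (hadj b).symm
    · obtain rfl : b = a + 1 := by rw [← h]; abel
      exact hadj a

theorem Represents.realize_noCycle (hG : Represents G) {n : ℕ} :
    M ⊨ noCycle n ↔ (SimpleGraph.cycleGraph (n + 3)).Free G := by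
  simp only [Sentence.Realize, noCycle, Formula.realize_iAlls, Formula.realize_not,
    Formula.realize_inf, realize_distinct, Formula.realize_iInf, realize_edge,
    Sum.elim_inr, hG _ _, SimpleGraph.Free, SimpleGraph.cycleGraph_isContained_iff_exists]
  simp only [not_exists]

theorem Represents.isAcyclic (hG : Represents G) (h : M ⊨ Set.range noCycle) : G.IsAcyclic := by
  rw [SimpleGraph.isAcyclic_iff_free_cycleGraph]
  intro n hn
  obtain ⟨k, rfl⟩ := Nat.exists_eq_add_of_le' hn
  exact hG.realize_noCycle.1 (Theory.realize_sentence_of_mem _ (Set.mem_range_self k))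

theorem represents_simpleGraphOfStructure [M ⊨ Theory.simpleGraph] :
    Represents (simpleGraphOfStructure M) := fun _ _ => Iff.rfl

/-- An acyclic graph, all of whose vertices have the same degree `D`. -/
structure IsRegularForest {V : Type*} (G : SimpleGraph V) (D : ℕ∞) : Prop where
  isAcyclic : G.IsAcyclic
  encard_neighborSet : ∀ x, (G.neighborSet x).encard = D

theorem exists_isRegularForest_of_regularTree {r : ℕ} (h : M ⊨ regularTree r) :
    ∃ G : SimpleGraph M, Represents G ∧ IsRegularForest G r := by
  simp only [regularTree, Theory.model_union_iff, Theory.model_singleton_iff] at h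
  have := h.1.1
  have hG := represents_simpleGraphOfStructure (M := M)
  exact ⟨_, hG, hG.isAcyclic h.2, hG.realize_degreeExactly.1 h.1.2⟩

theorem exists_isRegularForest_of_infiniteBranchingTree (h : M ⊨ infiniteBranchingTree) :
    ∃ G : SimpleGraph M, Represents G ∧ IsRegularForest G ⊤ := by
  simp only [infiniteBranchingTree, Theory.model_union_iff] at h
  have := h.1.1
  have hG := represents_simpleGraphOfStructure (M := M)
  refine ⟨_, hG, hG.isAcyclic h.2, fun x => ENat.eq_top_iff_forall_ge.2 fun n => ?_⟩
  have := h.1.2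
  exact hG.realize_degreeAtLeast.1 (Theory.realize_sentence_of_mem _ (Set.mem_range_self n)) x

end Realize

/-! ### Back-and-forth between regular forests -/

section BackAndForth

variable {V W : Type*} {G : SimpleGraph V} {H : SimpleGraph W}

/-- The finite partial matchings between two graphs that arise from the empty one by adding a pair
of vertices in new components or a pair of new neighbours of a pair already present. -/
inductive Matching (G : SimpleGraph V) (H : SimpleGraph W) : List (V × W) → Prop
  | nil : Matching G H []
  | new {l : List (V × W)} {x : V} {y : W} : Matching G H l →
      (∀ p ∈ l, ¬ G.Reachable p.1 x) → (∀ p ∈ l, ¬ H.Reachable p.2 y) → Matching G H ((x, y) :: l)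
  | grow {l : List (V × W)} {a x : V} {b y : W} : Matching G H l → (a, b) ∈ l →
      G.Adj a x → H.Adj b y → (∀ p ∈ l, p.1 ≠ x) → (∀ p ∈ l, p.2 ≠ y) → Matching G H ((x, y) :: l)

namespace Matching

theorem swap {l : List (V × W)} (h : Matching G H l) : Matching H G (l.map Prod.swap) := by
  induction h with
  | nil => exact .nil
  | new _ hx hy ih =>
    refine .new ih ?_ ?_
    · exact List.forall_mem_map.2 hy
    · exact List.forall_mem_map.2 hx
  | grow _ hab hx hy hx' hy' ih =>
    refine .grow ih (List.mem_map_of_mem (f := Prod.swap) hab) hy hx ?_ ?_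
    · exact List.forall_mem_map.2 hy'
    · exact List.forall_mem_map.2 hx'

/-- The matched vertices of one component span a subtree: `new` opens a one-point subtree in a fresh
component, and `grow` attaches a leaf. -/
theorem exists_isPath {l : List (V × W)} (h : Matching G H l) :
    ∀ p ∈ l, ∀ q ∈ l, G.Reachable p.1 q.1 →
      ∃ w : G.Walk p.1 q.1, w.IsPath ∧ ∀ z ∈ w.support, ∃ t ∈ l, t.1 = z := by
  induction h with
  | nil => simp
  | @new l x y _ hx hy ih =>
    intro p hp q hq hpq
    rcases List.mem_cons.1 hp with rfl | hp'
    · rcases List.mem_cons.1 hq with rfl | hq'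
      · exact ⟨.nil, by simp, by simp⟩
      · exact absurd hpq.symm (hx _ hq')
    · rcases List.mem_cons.1 hq with rfl | hq'
      · exact absurd hpq (hx _ hp')
      · obtain ⟨w, hw, hs⟩ := ih p hp' q hq' hpq
        refine ⟨w, hw, fun z hz => ?_⟩
        obtain ⟨t, ht, rfl⟩ := hs z hz
        exact ⟨t, List.mem_cons_of_mem _ ht, rfl⟩
  | @grow l a x b y _ hab hx hy hx' hy' ih =>
    have key : ∀ q ∈ l, G.Reachable x q.1 →
        ∃ w : G.Walk x q.1, w.IsPath ∧ ∀ z ∈ w.support, ∃ t ∈ (x, y) :: l, t.1 = z := by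
      intro q hq hxq
      obtain ⟨w, hw, hs⟩ := ih _ hab q hq (hx.reachable.trans hxq)
      refine ⟨.cons hx.symm w, (SimpleGraph.Walk.cons_isPath_iff _ _).2 ⟨hw, fun hmem => ?_⟩, ?_⟩
      · obtain ⟨t, ht, hte⟩ := hs _ hmem
        exact hx' t ht hte
      · intro z hz
        rcases List.mem_cons.1 ((SimpleGraph.Walk.support_cons hx.symm w) ▸ hz) with rfl | hz
        · exact ⟨_, List.mem_cons_self, rfl⟩
        · obtain ⟨t, ht, rfl⟩ := hs z hz
          exact ⟨t, List.mem_cons_of_mem _ ht, rfl⟩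
    intro p hp q hq hpq
    rcases List.mem_cons.1 hp with rfl | hp'
    · rcases List.mem_cons.1 hq with rfl | hq'
      · exact ⟨.nil, by simp, by simp⟩
      · exact key q hq' hpq
    · rcases List.mem_cons.1 hq with rfl | hq'
      · obtain ⟨w, hw, hs⟩ := key p hp' hpq.symm
        exact ⟨w.reverse, hw.reverse, by simpa using hs⟩
      · obtain ⟨w, hw, hs⟩ := ih p hp' q hq' hpq
        refine ⟨w, hw, fun z hz => ?_⟩
        obtain ⟨t, ht, rfl⟩ := hs z hz
        exact ⟨t, List.mem_cons_of_mem _ ht, rfl⟩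

/-- A vertex outside of a matching has at most one neighbour in it. -/
theorem fst_eq_of_adj {l : List (V × W)} (h : Matching G H l) (hG : G.IsAcyclic) {x : V}
    (hx : ∀ p ∈ l, p.1 ≠ x) {p q : V × W} (hp : p ∈ l) (hq : q ∈ l) (hpx : G.Adj p.1 x)
    (hqx : G.Adj q.1 x) : p.1 = q.1 := by
  by_contra hne
  obtain ⟨w, hw, hs⟩ := h.exists_isPath p hp q hq (hpx.reachable.trans hqx.symm.reachable)
  -- The path through `x` competes with one inside the matching; paths in a forest are unique, so
  -- `x` would be matched.
  let w' : G.Walk p.1 q.1 := .cons hpx (.cons hqx.symm .nil)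
  have hw' : w'.IsPath := by
    simp [w', SimpleGraph.Walk.cons_isPath_iff, hqx.ne', hpx.ne, hne]
  have heq : w = w' := congrArg Subtype.val
    ((hG.subsingleton_path _ _).elim ⟨w, hw⟩ ⟨w', hw'⟩)
  obtain ⟨t, ht, hte⟩ := hs x (by simp [heq, w'])
  exact hx t ht hte

/-- A matching is a partial isomorphism: a vertex added by `new` has no matched neighbour, and one
added by `grow` has only the vertex it was attached to, on both sides. -/
theorem fst_eq_iff_and_adj_iff {l : List (V × W)} (h : Matching G H l) (hG : G.IsAcyclic)
    (hH : H.IsAcyclic) : ∀ p ∈ l, ∀ q ∈ l,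
      (p.1 = q.1 ↔ p.2 = q.2) ∧ (G.Adj p.1 q.1 ↔ H.Adj p.2 q.2) := by
  induction h with
  | nil => simp
  | @new l x y _ hx hy ih =>
    have key : ∀ q ∈ l, (x = q.1 ↔ y = q.2) ∧ (G.Adj x q.1 ↔ H.Adj y q.2) := by
      intro q hq
      refine ⟨iff_of_false ?_ ?_, iff_of_false ?_ ?_⟩
      · rintro rfl
        exact hx q hq .rfl
      · rintro rfl
        exact hy q hq .rfl
      · exact fun h => hx q hq h.symm.reachable
      · exact fun h => hy q hq h.symm.reachable
    intro p hp q hq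
    rcases List.mem_cons.1 hp with rfl | hp' <;> rcases List.mem_cons.1 hq with rfl | hq'
    · simp
    · exact key q hq'
    · have := key p hp'
      rwa [eq_comm, @eq_comm _ y, G.adj_comm, H.adj_comm] at this
    · exact ih p hp' q hq'
  | @grow l a x b y hl hab hx hy hx' hy' ih =>
    have hy'' : ∀ p ∈ l.map Prod.swap, p.1 ≠ y :=
      List.forall_mem_map.2 hy'
    have key : ∀ q ∈ l, (x = q.1 ↔ y = q.2) ∧ (G.Adj x q.1 ↔ H.Adj y q.2) := by
      intro q hq
      refine ⟨iff_of_false (hx' q hq).symm (hy' q hq).symm, ?_⟩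
      have h1 : G.Adj x q.1 ↔ q.1 = a :=
        ⟨fun h => hl.fst_eq_of_adj hG hx' hq hab h.symm hx, fun h => h ▸ hx.symm⟩
      have h2 : H.Adj y q.2 ↔ q.2 = b :=
        ⟨fun h => hl.swap.fst_eq_of_adj hH hy'' (List.mem_map_of_mem (f := Prod.swap) hq)
          (List.mem_map_of_mem (f := Prod.swap) hab) h.symm hy, fun h => h ▸ hy.symm⟩
      rw [h1, h2]
      exact (ih q hq _ hab).1
    intro p hp q hq
    rcases List.mem_cons.1 hp with rfl | hp' <;> rcases List.mem_cons.1 hq with rfl | hq'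
    · simp
    · exact key q hq'
    · have := key p hp'
      rwa [eq_comm, @eq_comm _ y, G.adj_comm, H.adj_comm] at this
    · exact ih p hp' q hq'

/-- Counting: if all neighbours of `b` were matched, their partners would be `D` neighbours of `a`,
finitely many, hence all of them, including the unmatched `x`. -/
theorem exists_adj {D : ℕ∞} (hG : IsRegularForest G D) (hH : IsRegularForest H D)
    {l : List (V × W)} (h : Matching G H l) {a x : V} {b : W} (hab : (a, b) ∈ l)
    (hax : G.Adj a x) (hx : ∀ p ∈ l, p.1 ≠ x) : ∃ y, H.Adj b y ∧ ∀ p ∈ l, p.2 ≠ y := by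
  by_contra! hcon
  have hiso := h.fst_eq_iff_and_adj_iff hG.isAcyclic hH.isAcyclic
  let P : Set (V × W) := {p | p ∈ l ∧ G.Adj a p.1}
  have hPfin : P.Finite := l.finite_toSet.subset fun p hp => hp.1
  have h1 : (Prod.fst '' P).encard = P.encard :=
    Set.InjOn.encard_image fun p hp q hq hpq => Prod.ext hpq ((hiso p hp.1 q hq.1).1.1 hpq)
  have h2 : (Prod.snd '' P).encard = P.encard :=
    Set.InjOn.encard_image fun p hp q hq hpq => Prod.ext ((hiso p hp.1 q hq.1).1.2 hpq) hpq
  have h3 : Prod.snd '' P = H.neighborSet b := by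
    ext y
    constructor
    · rintro ⟨p, hp, rfl⟩
      exact (hiso _ hab p hp.1).2.1 hp.2
    · intro hy
      obtain ⟨p, hp, rfl⟩ := hcon y hy
      exact ⟨p, ⟨hp, (hiso _ hab p hp).2.2 hy⟩, rfl⟩
  have h4 : Prod.fst '' P ⊆ G.neighborSet a := by
    rintro _ ⟨p, hp, rfl⟩
    exact hp.2
  have h5 : Prod.fst '' P = G.neighborSet a :=
    (hPfin.image _).eq_of_subset_of_encard_le h4 <| by
      rw [h1, ← h2, h3, hG.encard_neighborSet, hH.encard_neighborSet]
  obtain ⟨p, hp, hpx⟩ : x ∈ Prod.fst '' P := h5 ▸ hax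
  exact hx p hp.1 hpx

theorem exists_of_walk {D : ℕ∞} (hG : IsRegularForest G D) (hH : IsRegularForest H D)
    {u x : V} (w : G.Walk u x) : ∀ {l : List (V × W)}, Matching G H l → (∃ b, (u, b) ∈ l) →
      ∃ l', Matching G H l' ∧ l ⊆ l' ∧ ∃ y, (x, y) ∈ l' := by
  induction w with
  | nil => exact fun {l} hl hb => ⟨l, hl, List.Subset.refl _, hb⟩
  | @cons u v x huv w ih =>
    rintro l hl ⟨b, hb⟩
    by_cases hv : ∃ p ∈ l, p.1 = v
    · obtain ⟨p, hp, rfl⟩ := hv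
      exact ih hl ⟨p.2, hp⟩
    · push Not at hv
      obtain ⟨y, hby, hy⟩ := hl.exists_adj hG hH hb huv hv
      obtain ⟨l', hl', hsub, hx⟩ := ih (hl.grow hb huv hby hv hy) ⟨y, List.mem_cons_self⟩
      exact ⟨l', hl', fun p hp => hsub (List.mem_cons_of_mem _ hp), hx⟩

end Matching

/-- Every finite set of vertices misses a connected component. -/
def ManyComponents (G : SimpleGraph V) : Prop :=
  ∀ s : Set V, s.Finite → ∃ x, ∀ a ∈ s, ¬ G.Reachable a x

/-- A vertex in a component already met is reached by growing along a walk; otherwise it is paired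
with a vertex in a fresh component of `H`. -/
theorem Matching.forth {D : ℕ∞} (hG : IsRegularForest G D) (hH : IsRegularForest H D)
    (hHm : ManyComponents H) {l : List (V × W)} (h : Matching G H l) (x : V) :
    ∃ l', Matching G H l' ∧ l ⊆ l' ∧ ∃ y, (x, y) ∈ l' := by
  by_cases hx : ∃ p ∈ l, G.Reachable p.1 x
  · obtain ⟨p, hp, ⟨w⟩⟩ := hx
    exact Matching.exists_of_walk hG hH w h ⟨p.2, hp⟩
  · push Not at hx
    obtain ⟨y, hy⟩ := hHm (Prod.snd '' {p | p ∈ l}) (l.finite_toSet.image _)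
    exact ⟨(x, y) :: l, h.new hx fun p hp => hy _ ⟨p, hp, rfl⟩, List.subset_cons_self _ _, y,
      List.mem_cons_self⟩

theorem Matching.back {D : ℕ∞} (hG : IsRegularForest G D) (hH : IsRegularForest H D)
    (hGm : ManyComponents G) {l : List (V × W)} (h : Matching G H l) (y : W) :
    ∃ l', Matching G H l' ∧ l ⊆ l' ∧ ∃ x, (x, y) ∈ l' := by
  obtain ⟨l', hl', hsub, x, hx⟩ := h.swap.forth hH hG hGm y
  refine ⟨l'.map Prod.swap, hl'.swap, fun p hp => ?_, x, List.mem_map_of_mem (f := Prod.swap) hx⟩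
  exact List.mem_map.2 ⟨p.swap, hsub (List.mem_map_of_mem hp), by simp⟩

end BackAndForth

/-! ### From matchings to elementary equivalence -/

theorem exists_eq_var {β : Type*} (t : Language.graph.Term β) : ∃ i, t = Term.var i := by
  cases t with
  | var i => exact ⟨i, rfl⟩
  | func f => exact f.elim

section Realize

variable {M N : Type w} [Language.graph.Structure M] [Language.graph.Structure N]
  {G : SimpleGraph M} {H : SimpleGraph N}

theorem realize_iff_of_matching (hGr : Represents G) (hHr : Represents H) {D : ℕ∞}
    (hG : IsRegularForest G D) (hH : IsRegularForest H D)
    (hGm : ManyComponents G) (hHm : ManyComponents H)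
    {α : Type*} {n : ℕ} (φ : Language.graph.BoundedFormula α n) :
    ∀ {v : α → M} {v' : α → N} {xs : Fin n → M} {xs' : Fin n → N} {l : List (M × N)},
      Matching G H l → (∀ i, (v i, v' i) ∈ l) → (∀ i, (xs i, xs' i) ∈ l) →
      (φ.Realize v xs ↔ φ.Realize v' xs') := by
  induction φ with
  | falsum => intros; rfl
  | equal t₁ t₂ =>
    intro v v' xs xs' l hl hv hxs
    obtain ⟨i, rfl⟩ := exists_eq_var t₁
    obtain ⟨j, rfl⟩ := exists_eq_var t₂
    have hmem : ∀ i, (Sum.elim v xs i, Sum.elim v' xs' i) ∈ l := by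
      rintro (i | i) <;> simp [hv, hxs]
    exact (hl.fst_eq_iff_and_adj_iff hG.isAcyclic hH.isAcyclic _ (hmem i) _ (hmem j)).1
  | rel R ts =>
    intro v v' xs xs' l hl hv hxs
    have hmem : ∀ i, (Sum.elim v xs i, Sum.elim v' xs' i) ∈ l := by
      rintro (i | i) <;> simp [hv, hxs]
    cases R
    obtain ⟨i, hi⟩ := exists_eq_var (ts 0)
    obtain ⟨j, hj⟩ := exists_eq_var (ts 1)
    have h1 : (fun k => (ts k).realize (Sum.elim v xs)) = ![Sum.elim v xs i, Sum.elim v xs j] := by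
      ext k; fin_cases k <;> simp [hi, hj]
    have h2 : (fun k => (ts k).realize (Sum.elim v' xs')) =
        ![Sum.elim v' xs' i, Sum.elim v' xs' j] := by
      ext k; fin_cases k <;> simp [hi, hj]
    change Structure.RelMap adj _ ↔ Structure.RelMap adj _
    rw [h1, h2, hGr, hHr]
    exact (hl.fst_eq_iff_and_adj_iff hG.isAcyclic hH.isAcyclic _ (hmem i) _ (hmem j)).2
  | imp _ _ ih₁ ih₂ =>
    intro v v' xs xs' l hl hv hxs
    exact imp_congr (ih₁ hl hv hxs) (ih₂ hl hv hxs)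
  | @all n φ ih =>
    intro v v' xs xs' l hl hv hxs
    have hsnoc : ∀ {l' : List (M × N)} {x y}, l ⊆ l' → (x, y) ∈ l' →
        ∀ i : Fin (n + 1), ((Fin.snoc xs x : Fin (n + 1) → M) i,
          (Fin.snoc xs' y : Fin (n + 1) → N) i) ∈ l' := by
      intro l' x y hsub hxy i
      refine Fin.lastCases ?_ (fun i => ?_) i
      · simpa using hxy
      · simpa using hsub (hxs i)
    simp only [BoundedFormula.realize_all]
    constructor
    · intro h y
      obtain ⟨l', hl', hsub, x, hxy⟩ := hl.back hG hH hGm y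
      exact (ih hl' (fun i => hsub (hv i)) (hsnoc hsub hxy)).1 (h x)
    · intro h x
      obtain ⟨l', hl', hsub, y, hxy⟩ := hl.forth hG hH hHm x
      exact (ih hl' (fun i => hsub (hv i)) (hsnoc hsub hxy)).2 (h y)

theorem elementarilyEquivalent_of_manyComponents (hGr : Represents G) (hHr : Represents H)
    {D : ℕ∞} (hG : IsRegularForest G D) (hH : IsRegularForest H D)
    (hGm : ManyComponents G) (hHm : ManyComponents H) :
    Language.graph.ElementarilyEquivalent M N :=
  elementarilyEquivalent_iff.2 fun φ =>
    realize_iff_of_matching hGr hHr hG hH hGm hHm φ .nil (fun i => i.elim) fun i => i.elim0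

end Realize

/-! ### Vertices far away in a regular forest -/

section Ray

variable {V : Type*} {G : SimpleGraph V}

theorem IsRegularForest.exists_ray [Nonempty V] {D : ℕ∞} (hG : IsRegularForest G D) (hD : 2 ≤ D) :
    ∃ x : ℕ → V, ∀ n, G.Adj (x n) (x (n + 1)) ∧ x (n + 2) ≠ x n := by
  have hdeg : ∀ a, 1 < (G.neighborSet a).encard := fun a => by
    rw [hG.encard_neighborSet a]
    exact lt_of_lt_of_le (by norm_num) hD
  have hnext : ∀ a b, ∃ c, G.Adj b c ∧ c ≠ a := by
    intro a b
    obtain ⟨c, d, hc, hd, hcd⟩ := Set.one_lt_encard_iff.1 (hdeg b)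
    by_cases hca : c = a
    · exact ⟨d, hd, fun hda => hcd (hca.trans hda.symm)⟩
    · exact ⟨c, hc, hca⟩
  choose next hadj hne using hnext
  obtain ⟨a⟩ := ‹Nonempty V›
  -- The state is a pair of consecutive vertices, so that the next step can avoid backtracking.
  let f : ℕ → V × V := fun n => (fun p : V × V => (p.2, next p.1 p.2))^[n] (a, next a a)
  have hf : ∀ n, f (n + 1) = ((f n).2, next (f n).1 (f n).2) := fun n =>
    Function.iterate_succ_apply' _ _ _
  refine ⟨fun n => (f n).1, fun n => ⟨?_, ?_⟩⟩
  · cases n with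
    | zero => exact hadj _ _
    | succ n => simpa only [hf] using hadj _ _
  · simpa only [hf] using hne _ _

theorem _root_.SimpleGraph.IsAcyclic.length_le_of_isPath (hG : G.IsAcyclic) {u v : V}
    {p : G.Walk u v} (hp : p.IsPath) (q : G.Walk u v) : p.length ≤ q.length := by
  classical
  have : p = q.bypass :=
    congrArg Subtype.val ((hG.subsingleton_path u v).elim ⟨p, hp⟩ ⟨q.bypass, q.bypass_isPath⟩)
  rw [this]
  exact q.length_bypass_le_length

theorem _root_.SimpleGraph.IsAcyclic.exists_isPath_of_ray (hG : G.IsAcyclic) {x : ℕ → V}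
    (hx : ∀ n, G.Adj (x n) (x (n + 1)) ∧ x (n + 2) ≠ x n) (m j : ℕ) :
    ∃ p : G.Walk (x (m + j + 1)) (x m), p.IsPath ∧ p.length = j + 1 ∧ p.snd = x (m + j) := by
  induction j with
  | zero => exact ⟨.cons (hx m).1.symm .nil, by simp [(hx m).1.ne'], rfl, by simp⟩
  | succ j ih =>
    obtain ⟨p, hp, hl, hs⟩ := ih
    refine ⟨.cons (hx (m + j + 1)).1.symm p,
      (SimpleGraph.Walk.cons_isPath_iff _ _).2 ⟨hp, fun hmem => ?_⟩, by simp [hl], by simp; rfl⟩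
    -- In a forest, a neighbour of the start of a path that lies on the path is its second vertex;
    -- here that would be a backtrack.
    exact (hx (m + j)).2 ((hG.eq_snd_of_adj_start hp (hx (m + j + 1)).1 hmem).trans hs)

/-- A non-backtracking ray is geodesic in a forest. If it stayed within distance `k` of `s`, two of
its points more than `2 * k` steps apart would be close to the same `a`, hence within `2 * k` of
each other. -/
theorem IsRegularForest.exists_forall_lt_length [Nonempty V] {D : ℕ∞} (hG : IsRegularForest G D)
    (hD : 2 ≤ D) {s : Set V} (hs : s.Finite) (k : ℕ) :
    ∃ x, ∀ a ∈ s, ∀ w : G.Walk a x, k < w.length := by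
  by_contra! hcon
  obtain ⟨x, hx⟩ := hG.exists_ray hD
  choose a has w hw using fun n => hcon (x n)
  have : Finite s := hs
  obtain ⟨c, hc⟩ := Finite.exists_infinite_fiber fun n => (⟨a n, has n⟩ : s)
  rw [Set.infinite_coe_iff] at hc
  obtain ⟨m, hm⟩ := hc.nonempty
  obtain ⟨n, hn, hmn⟩ := hc.exists_gt (m + 2 * k)
  have han : a n = a m := congrArg Subtype.val (hn.trans hm.symm)
  obtain ⟨j, rfl⟩ := Nat.exists_eq_add_of_lt (show m < n by lia)
  obtain ⟨p, hp, hl, -⟩ := hG.isAcyclic.exists_isPath_of_ray hx m j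
  have hle := hG.isAcyclic.length_le_of_isPath hp
    ((w (m + j + 1)).reverse.append ((w m).copy han.symm rfl))
  have h1 := hw (m + j + 1)
  have h2 := hw m
  simp only [SimpleGraph.Walk.length_append, SimpleGraph.Walk.length_reverse,
    SimpleGraph.Walk.length_copy] at hle
  lia

end Ray

/-! ### Ultrapowers have infinitely many components -/

section Ultrapower

open Filter

variable {M : Type w} [Language.graph.Structure M] {U : Ultrafilter ℕ}

theorem relMap_ultrapower {f g : ℕ → M} :
    Structure.RelMap adj ![(f : (U : Filter ℕ).Product fun _ => M),
      (g : (U : Filter ℕ).Product fun _ => M)] ↔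
      ∀ᶠ k in U, Structure.RelMap adj ![f k, g k] := by
  obtain ⟨⟩ | _ := isEmpty_or_nonempty M
  · exact (IsEmpty.false (f 0)).elim
  · have := Ultraproduct.realize_formula_cast (u := U) (M := fun _ : ℕ => M)
      (edge (0 : Fin 2) 1) ![f, g]
    simpa using this

/-- A walk has finitely many edges, so all of them are present at once in almost every coordinate.
-/
theorem eventually_exists_walk {G : SimpleGraph M} (hG : Represents G)
    {G' : SimpleGraph ((U : Filter ℕ).Product fun _ => M)} (hG' : Represents G')
    {p q : (U : Filter ℕ).Product fun _ => M} (w : G'.Walk p q) :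
    ∀ f g : ℕ → M, (f : (U : Filter ℕ).Product fun _ => M) = p →
      (g : (U : Filter ℕ).Product fun _ => M) = q →
      ∀ᶠ k in U, ∃ w' : G.Walk (f k) (g k), w'.length = w.length := by
  induction w with
  | nil =>
    intro f g hf hg
    have : ∀ᶠ k in U, f k = g k := Quotient.exact (hf.trans hg.symm)
    filter_upwards [this] with k hk
    exact ⟨SimpleGraph.Walk.nil.copy rfl hk, by simp⟩
  | @cons p r q h w ih =>
    intro f g hf hg
    obtain ⟨e, rfl⟩ := Quotient.exists_rep r
    subst hf
    filter_upwards [ih e g rfl hg, relMap_ultrapower.1 ((hG' _ _).2 h)] with k ⟨w', hw'⟩ hadj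
    exact ⟨.cons ((hG _ _).1 hadj) w', congrArg (· + 1) hw'⟩

theorem manyComponents_ultrapower [Nonempty M] {G : SimpleGraph M} (hG : Represents G)
    {D : ℕ∞} (hGD : IsRegularForest G D) (hD : 2 ≤ D) (hU : (U : Filter ℕ) ≤ cofinite)
    {G' : SimpleGraph ((U : Filter ℕ).Product fun _ => M)} (hG' : Represents G') :
    ManyComponents G' := by
  intro s hs
  have hout : ∀ a : (U : Filter ℕ).Product fun _ => M, ∃ f : ℕ → M,
      (f : (U : Filter ℕ).Product fun _ => M) = a := Quotient.exists_rep
  choose rep hrep using hout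
  -- Diagonal choice: the `k`-th coordinate of the new vertex is farther than `k` from the `k`-th
  -- coordinates of `s`, which excludes walks of any fixed length.
  choose x hx using fun k => hGD.exists_forall_lt_length hD (hs.image fun a => rep a k) k
  refine ⟨(x : (U : Filter ℕ).Product fun _ => M), fun a ha ⟨w⟩ => ?_⟩
  have hlarge : ∀ᶠ k in (U : Filter ℕ), w.length ≤ k :=
    hU (Nat.cofinite_eq_atTop ▸ eventually_ge_atTop w.length)
  obtain ⟨k, ⟨w', hw'⟩, hk⟩ :=
    ((eventually_exists_walk hG hG' w (rep a) x (hrep a) rfl).and hlarge).exists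
  have := hx k (rep a k) ⟨a, ha, rfl⟩ w'
  lia

theorem elementarilyEquivalent_ultrapower [Nonempty M] :
    Language.graph.ElementarilyEquivalent M ((U : Filter ℕ).Product fun _ => M) :=
  elementarilyEquivalent_iff.2 fun φ => by
    rw [Ultraproduct.sentence_realize, eventually_const]

end Ultrapower

/-! ### Completeness -/

section Complete

open Filter

theorem isComplete_of_forall_isRegularForest {T : Language.graph.Theory} (hT : T.IsSatisfiable)
    {D : ℕ∞} (hD : 2 ≤ D) (h : ∀ (M : Type) [Language.graph.Structure M], M ⊨ T →
      ∃ G : SimpleGraph M, Represents G ∧ IsRegularForest G D) : T.IsComplete := by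
  refine Theory.IsComplete.isComplete_iff_models_elementarily_equivalent.2 ⟨hT, fun M N => ?_⟩
  let M' := (hyperfilter ℕ : Filter ℕ).Product fun _ => M
  let N' := (hyperfilter ℕ : Filter ℕ).Product fun _ => N
  have hMM' : Language.graph.ElementarilyEquivalent M M' := elementarilyEquivalent_ultrapower
  have hNN' : Language.graph.ElementarilyEquivalent N N' := elementarilyEquivalent_ultrapower
  obtain ⟨G, hGr, hG⟩ := h M M.is_model
  obtain ⟨H, hHr, hH⟩ := h N N.is_model
  obtain ⟨G', hGr', hG'⟩ := h M' (hMM'.theory_model_iff.1 M.is_model)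
  obtain ⟨H', hHr', hH'⟩ := h N' (hNN'.theory_model_iff.1 N.is_model)
  have := elementarilyEquivalent_of_manyComponents hGr' hHr' hG' hH'
    (manyComponents_ultrapower hGr hG hD (hyperfilter_le_cofinite) hGr')
    (manyComponents_ultrapower hHr hH hD (hyperfilter_le_cofinite) hHr')
  exact (hMM'.trans this).trans hNN'.symm

end Complete

/-! ### Finite regular graphs of large girth -/

section HighGirth

variable {r g : ℕ}

/-- Words of length at most `g + 1` in `r` letters without repeated consecutive letters: the
vertices of a ball in the edge-coloured `r`-regular tree. -/
abbrev ReducedWord (r g : ℕ) : Type :=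
  {l : List (Fin r) // l.IsChain (· ≠ ·) ∧ l.length ≤ g + 1}

instance : Finite (ReducedWord r g) :=
  ((List.finite_length_le (Fin r) (g + 1)).subset fun _ h => h.2).to_subtype

/-- Move along the edge of colour `i`, if there is one. -/
def toggle (g : ℕ) (i : Fin r) : List (Fin r) → List (Fin r)
  | [] => [i]
  | j :: l => if j = i then l else if l.length < g then i :: j :: l else j :: l

theorem toggle_mem (i : Fin r) {l : List (Fin r)}
    (hl : l.IsChain (· ≠ ·) ∧ l.length ≤ g + 1) :
    (toggle g i l).IsChain (· ≠ ·) ∧ (toggle g i l).length ≤ g + 1 := by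
  cases l with
  | nil => simp [toggle]
  | cons j l =>
    obtain ⟨h1, h2⟩ := hl
    rw [List.length_cons] at h2
    simp only [toggle]
    split_ifs with hj hlt
    · exact ⟨h1.tail, by lia⟩
    · exact ⟨List.isChain_cons_cons.2 ⟨Ne.symm hj, h1⟩, by simp; lia⟩
    · exact ⟨h1, by simpa using h2⟩

/-- A letter just added is removed again. A letter just removed is put back, since reducedness makes
the next letter different and the shortened word has room. A word of full length `g + 1` not
starting with `i` is fixed. -/
theorem toggle_toggle (i : Fin r) {l : List (Fin r)} (hl : l.IsChain (· ≠ ·))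
    (hlen : l.length ≤ g + 1) : toggle g i (toggle g i l) = l := by
  cases l with
  | nil => simp [toggle]
  | cons j l =>
    by_cases hj : j = i
    · subst hj
      cases l with
      | nil => simp [toggle]
      | cons k l =>
        have hk : j ≠ k := (List.isChain_cons_cons.1 hl).1
        have : l.length < g := by simpa using hlen
        simp [toggle, hk.symm, this]
    · by_cases hlt : l.length < g
      · simp [toggle, hj, hlt]
      · simp [toggle, hj, hlt]

/-- The involution of the reduced words that moves along the edges of colour `i`. -/
def flip (i : Fin r) : Equiv.Perm (ReducedWord r g) :=
  Function.Involutive.toPerm (fun l => ⟨toggle g i l.1, toggle_mem i l.2⟩) fun l =>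
    Subtype.ext (toggle_toggle i l.2.1 l.2.2)

theorem flip_mul_flip_mul (i : Fin r) (π : Equiv.Perm (ReducedWord r g)) :
    flip i * (flip i * π) = π := by
  refine Equiv.ext fun l => Subtype.ext ?_
  exact toggle_toggle i (π l).2.1 (π l).2.2

/-- The empty word. -/
def ReducedWord.root : ReducedWord r g := ⟨[], by simp⟩

theorem flip_root (i : Fin r) : (flip i (ReducedWord.root (g := g))).1 = [i] := rfl

theorem flip_injective : Function.Injective (flip (r := r) (g := g)) := by
  intro i j h
  have := flip_root (g := g) i
  rw [h, flip_root] at this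
  simpa using this.symm

/-- The Cayley graph of the permutations of the reduced words, with respect to the involutions
`flip i`. -/
def flipGraph (r g : ℕ) : SimpleGraph (Equiv.Perm (ReducedWord r g)) where
  Adj π τ := ∃ i, τ = flip i * π
  symm := ⟨by
    rintro π _ ⟨i, rfl⟩
    exact ⟨i, (flip_mul_flip_mul i π).symm⟩⟩
  loopless := ⟨by
    rintro π ⟨i, hi⟩
    have h1 : (flip i : Equiv.Perm (ReducedWord r g)) = 1 := by simpa using hi.symm
    have h2 := flip_root (g := g) i
    rw [h1] at h2
    exact List.cons_ne_nil _ _ h2.symm⟩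

theorem encard_neighborSet_flipGraph (π : Equiv.Perm (ReducedWord r g)) :
    ((flipGraph r g).neighborSet π).encard = r := by
  refine Set.encard_eq_coe_iff_exists_range.2 ⟨fun i => flip i * π,
    (mul_left_injective π).comp flip_injective, ?_⟩
  ext τ
  exact exists_congr fun i => eq_comm

/-- The position of the empty word after moving along a walk from `τ` to `π`. -/
def displacement (π τ : Equiv.Perm (ReducedWord r g)) : List (Fin r) :=
  ((π * τ⁻¹) ReducedWord.root).1

theorem displacement_self (π : Equiv.Perm (ReducedWord r g)) : displacement π π = [] := by
  simp [displacement, ReducedWord.root]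

theorem displacement_flip_mul (i : Fin r) (π τ : Equiv.Perm (ReducedWord r g)) :
    displacement (flip i * π) τ = toggle g i (displacement π τ) := rfl

/-- Read from its end, a path of length at most `g + 1` never repeats a colour immediately, so each
edge pushes the root one level further out. The claim on the head letter remembers the last colour
used, which the induction needs. -/
theorem length_displacement {π τ : Equiv.Perm (ReducedWord r g)}
    (p : (flipGraph r g).Walk π τ) (hp : p.IsPath) (hlen : p.length ≤ g + 1) :
    (displacement π τ).length = p.length ∧
      ∀ i ∈ (displacement π τ).head?, p.snd = flip i * π := by
  induction p with
  | nil => simp [displacement_self]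
  | @cons π ρ τ h p ih =>
    rw [SimpleGraph.Walk.cons_isPath_iff] at hp
    rw [SimpleGraph.Walk.length_cons] at hlen
    obtain ⟨ih₁, ih₂⟩ := ih hp.1 (by lia)
    rw [SimpleGraph.Walk.length_cons, SimpleGraph.Walk.snd_cons]
    obtain ⟨i, rfl⟩ := h
    have hπ := displacement_flip_mul i (flip i * π) τ
    rw [flip_mul_flip_mul] at hπ
    rw [hπ]
    generalize displacement (flip i * π) τ = l at ih₁ ih₂
    cases l with
    | nil => exact ⟨congrArg (· + 1) ih₁, by simp [toggle]⟩
    | cons j l =>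
      -- Removing a letter would mean that the path returns at once to `π`.
      have hj : j ≠ i := by
        rintro rfl
        refine hp.2 ?_
        have := ih₂ j rfl
        rw [flip_mul_flip_mul] at this
        have hmem : p.snd ∈ p.support := p.getVert_mem_support 1
        rwa [this] at hmem
      have hlt : l.length < g := by
        rw [List.length_cons] at ih₁
        lia
      exact ⟨by simpa [toggle, hj, hlt] using ih₁, by simp [toggle, hj, hlt]⟩

theorem lt_length_of_isCycle_flipGraph {π : Equiv.Perm (ReducedWord r g)}
    {c : (flipGraph r g).Walk π π} (hc : c.IsCycle) : g + 2 < c.length := by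
  by_contra! hle
  have h3 := hc.three_le_length
  cases c with
  | nil => simp at h3
  | cons h p =>
    rw [SimpleGraph.Walk.cons_isCycle_iff] at hc
    rw [SimpleGraph.Walk.length_cons] at hle h3
    -- Without its first edge the cycle is a path between adjacent vertices, whose displacement is a
    -- single letter; so the path has length 1, too short for a cycle.
    have hlen := (length_displacement p hc.1 (by lia)).1
    obtain ⟨i, rfl⟩ := h
    rw [displacement_flip_mul, displacement_self] at hlen
    simp only [toggle, List.length_singleton] at hlen
    lia

/-- A finite regular forest of degree at least 2 would have a vertex at positive distance from every
vertex, itself included. This is needed because `girth` is 0 on acyclic graphs. -/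
theorem not_isAcyclic_flipGraph (hr : 2 ≤ r) : ¬ (flipGraph r g).IsAcyclic := by
  intro h
  obtain ⟨x, hx⟩ := IsRegularForest.exists_forall_lt_length (D := r)
    ⟨h, encard_neighborSet_flipGraph⟩ (by exact_mod_cast hr) Set.finite_univ 0
  simpa using hx x trivial .nil

theorem lt_girth_flipGraph (hr : 2 ≤ r) : g + 2 < (flipGraph r g).girth := by
  obtain ⟨π, c, hc, hgirth⟩ :=
    SimpleGraph.exists_girth_eq_length.2 (not_isAcyclic_flipGraph (g := g) hr)
  rw [hgirth]
  exact lt_length_of_isCycle_flipGraph hc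

theorem free_cycleGraph_flipGraph {n : ℕ} (hn : n ≤ g) :
    (SimpleGraph.cycleGraph (n + 3)).Free (flipGraph r (g + 1)) := by
  intro h
  obtain ⟨π, c, hc, hlen⟩ := (SimpleGraph.cycleGraph_isContained_iff (by lia)).1 h
  have := lt_length_of_isCycle_flipGraph hc
  lia

end HighGirth

/-! ### Ultraproducts of the finite graphs and pseudofiniteness -/

section Ultraproduct

open Filter

theorem represents_structure {V : Type*} (G : SimpleGraph V) :
    letI := G.structure
    Represents G := fun _ _ => Iff.rfl

variable {V : ℕ → Type} [∀ k, Nonempty (V k)] {G : ∀ k, SimpleGraph (V k)} {U : Ultrafilter ℕ}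
  {T : Language.graph.Theory}

/-- By Łoś, since a non-principal ultrafilter on `ℕ` contains every cofinite set. -/
theorem ultraproductModels_of_eventually (hU : ∀ n, U ≠ pure n)
    (h : ∀ φ ∈ T, ∀ᶠ k in atTop, @Sentence.Realize _ (V k) (G k).structure φ) :
    UltraproductModels G U T := by
  have hle : (U : Filter ℕ) ≤ cofinite :=
    U.le_cofinite_or_eq_pure.resolve_right fun ⟨n, hn⟩ => hU n hn
  let : ∀ k, Language.graph.Structure (V k) := fun k => (G k).structure
  refine ⟨fun φ hφ => (Ultraproduct.sentence_realize φ).2 (hle ?_)⟩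
  rw [Nat.cofinite_eq_atTop]
  exact h φ hφ

theorem isSatisfiable_of_ultraproductModels (h : UltraproductModels G U T) : T.IsSatisfiable := by
  let : ∀ k, Language.graph.Structure (V k) := fun k => (G k).structure
  have : (U : Filter ℕ).Product V ⊨ T := h
  exact Theory.Model.isSatisfiable ((U : Filter ℕ).Product V)

theorem pseudofiniteTheory_of_ultraproductModels [∀ k, Finite (V k)]
    (hT : T.IsComplete) (h : UltraproductModels G U T) : PseudofiniteTheory.{0, 0, w} T := by
  intro M _ _ hM φ hφ
  let : ∀ k, Language.graph.Structure (V k) := fun k => (G k).structure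
  have : (U : Filter ℕ).Product V ⊨ T := h
  have hφ' := (hT.realize_sentence_iff φ ((U : Filter ℕ).Product V)).2
    ((hT.realize_sentence_iff φ M).1 hφ)
  obtain ⟨k, hk⟩ := ((Ultraproduct.sentence_realize φ).1 hφ').exists
  exact ⟨V k, inferInstance, inferInstance, inferInstance, hk⟩

theorem hyperfilter_ne_pure (n : ℕ) : hyperfilter ℕ ≠ pure n := by
  intro h
  have : ({n} : Set ℕ)ᶜ ∈ hyperfilter ℕ :=
    compl_mem_hyperfilter_of_finite (Set.finite_singleton n)
  rw [h] at this
  exact this rfl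

theorem ultraproductModels_regularTree (r : ℕ) {U : Ultrafilter ℕ} (hU : ∀ n, U ≠ pure n) :
    UltraproductModels (fun k => flipGraph r (k + 1)) U (regularTree r) := by
  refine ultraproductModels_of_eventually hU ?_
  rintro φ ((hφ | rfl) | ⟨n, rfl⟩)
  · refine .of_forall fun k => ?_
    let := (flipGraph r (k + 1)).structure
    exact Theory.realize_sentence_of_mem Theory.simpleGraph hφ
  · refine .of_forall fun k => ?_
    let := (flipGraph r (k + 1)).structure
    exact (represents_structure (flipGraph r (k + 1))).realize_degreeExactly.2
      encard_neighborSet_flipGraph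
  · filter_upwards [eventually_ge_atTop n] with k hk
    let := (flipGraph r (k + 1)).structure
    exact (represents_structure (flipGraph r (k + 1))).realize_noCycle.2
      (free_cycleGraph_flipGraph hk)

theorem ultraproductModels_infiniteBranchingTree {U : Ultrafilter ℕ} (hU : ∀ n, U ≠ pure n) :
    UltraproductModels (fun k => flipGraph (k + 2) (k + 1)) U infiniteBranchingTree := by
  refine ultraproductModels_of_eventually hU ?_
  rintro φ ((hφ | ⟨n, rfl⟩) | ⟨n, rfl⟩)
  · refine .of_forall fun k => ?_
    let := (flipGraph (k + 2) (k + 1)).structure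
    exact Theory.realize_sentence_of_mem Theory.simpleGraph hφ
  · filter_upwards [eventually_ge_atTop n] with k hk
    let := (flipGraph (k + 2) (k + 1)).structure
    refine (represents_structure (flipGraph (k + 2) (k + 1))).realize_degreeAtLeast.2 fun x => ?_
    rw [encard_neighborSet_flipGraph]
    exact_mod_cast hk.trans (Nat.le_add_right k 2)
  · filter_upwards [eventually_ge_atTop n] with k hk
    let := (flipGraph (k + 2) (k + 1)).structure
    exact (represents_structure (flipGraph (k + 2) (k + 1))).realize_noCycle.2
      (free_cycleGraph_flipGraph hk)

theorem isComplete_regularTree {r : ℕ} (hr : 2 ≤ r) : (regularTree r).IsComplete :=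
  isComplete_of_forall_isRegularForest
    (isSatisfiable_of_ultraproductModels (ultraproductModels_regularTree r hyperfilter_ne_pure))
    (D := r) (by exact_mod_cast hr) fun _ _ => exists_isRegularForest_of_regularTree

theorem isComplete_infiniteBranchingTree : infiniteBranchingTree.IsComplete :=
  isComplete_of_forall_isRegularForest
    (isSatisfiable_of_ultraproductModels
      (ultraproductModels_infiniteBranchingTree hyperfilter_ne_pure))
    (D := ⊤) le_top fun _ _ => exists_isRegularForest_of_infiniteBranchingTree

theorem isRegularOfDegree_flipGraph (r g : ℕ) {_ : (flipGraph r g).LocallyFinite} :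
    (flipGraph r g).IsRegularOfDegree r := by
  intro π
  have := encard_neighborSet_flipGraph π
  rw [← SimpleGraph.coe_neighborFinset, Set.encard_coe_eq_coe_finsetCard] at this
  exact_mod_cast this

theorem tendsto_girth_flipGraph {d : ℕ → ℕ} (hd : ∀ k, 2 ≤ d k) :
    Tendsto (fun k => (flipGraph (d k) (k + 1)).girth) atTop atTop :=
  tendsto_atTop_mono (fun k => (by lia : k ≤ k + 1 + 2).trans (lt_girth_flipGraph (hd k)).le)
    tendsto_id

end Ultraproduct

end TreeTheories

theorem mainTheorem1 :
    (∀ r : ℕ, 2 ≤ r →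
      (TreeTheories.regularTree r).IsComplete ∧
      TreeTheories.PseudofiniteTheory.{0, 0, w} (TreeTheories.regularTree r) ∧
      ∃ (V : ℕ → Type) (_ : ∀ k, Fintype (V k)) (_ : ∀ k, Nonempty (V k))
        (G : ∀ k, SimpleGraph (V k)) (_ : ∀ k, (G k).LocallyFinite),
        (∀ k, (G k).IsRegularOfDegree r) ∧
        Filter.Tendsto (fun k => (G k).girth) Filter.atTop Filter.atTop ∧
        ∀ U : Ultrafilter ℕ, (∀ n, U ≠ pure n) →
          TreeTheories.UltraproductModels G U (TreeTheories.regularTree r)) ∧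
    (TreeTheories.infiniteBranchingTree.IsComplete ∧
      TreeTheories.PseudofiniteTheory.{0, 0, w} TreeTheories.infiniteBranchingTree ∧
      ∃ (V : ℕ → Type) (_ : ∀ k, Fintype (V k)) (_ : ∀ k, Nonempty (V k))
        (H : ∀ k, SimpleGraph (V k)) (_ : ∀ k, (H k).LocallyFinite) (d : ℕ → ℕ),
        (∀ k, (H k).IsRegularOfDegree (d k)) ∧
        Filter.Tendsto d Filter.atTop Filter.atTop ∧
        Filter.Tendsto (fun k => (H k).girth) Filter.atTop Filter.atTop ∧
        ∀ U : Ultrafilter ℕ, (∀ n, U ≠ pure n) →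
          TreeTheories.UltraproductModels H U TreeTheories.infiniteBranchingTree) := by
  refine ⟨fun r hr => ⟨TreeTheories.isComplete_regularTree hr,
    TreeTheories.pseudofiniteTheory_of_ultraproductModels (TreeTheories.isComplete_regularTree hr)
      (TreeTheories.ultraproductModels_regularTree r TreeTheories.hyperfilter_ne_pure),
    fun k => Equiv.Perm (TreeTheories.ReducedWord r (k + 1)), fun k => Fintype.ofFinite _,
    fun k => inferInstance, fun k => TreeTheories.flipGraph r (k + 1),
    fun k π => Fintype.ofFinite _, fun k => ?_, TreeTheories.tendsto_girth_flipGraph fun _ => hr,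
    fun U => TreeTheories.ultraproductModels_regularTree r⟩,
    TreeTheories.isComplete_infiniteBranchingTree,
    TreeTheories.pseudofiniteTheory_of_ultraproductModels
      TreeTheories.isComplete_infiniteBranchingTree
      (TreeTheories.ultraproductModels_infiniteBranchingTree TreeTheories.hyperfilter_ne_pure),
    fun k => Equiv.Perm (TreeTheories.ReducedWord (k + 2) (k + 1)), fun k => Fintype.ofFinite _,
    fun k => inferInstance, fun k => TreeTheories.flipGraph (k + 2) (k + 1),
    -- The shift by 2 keeps every degree at least 2, so that each graph has a cycle and its girth is
    -- not the default 0.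
    fun k π => Fintype.ofFinite _, fun k => k + 2, fun k => ?_,
    Filter.tendsto_add_atTop_nat 2, TreeTheories.tendsto_girth_flipGraph fun k => by lia,
    fun U => TreeTheories.ultraproductModels_infiniteBranchingTree⟩
  · exact TreeTheories.isRegularOfDegree_flipGraph r (k + 1)
  · exact TreeTheories.isRegularOfDegree_flipGraph (k + 2) (k + 1)
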